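/- **Setting.** An \emph{action family} consists of a set of instances and, for every security parameter $\ell\in\mathbb N$, a probability distribution on the instances (possibly a point mass). An instance consists of a finite abelian semigroup $G$, a finite set $S$, an action $\Phi:G\times S\to S$ (so $\Phi(gh,x)=\Phi(g,\Phi(h,x))$) and a public element $s\in S$. Instances, elements of $G$ and elements of $S$ are written as bit strings (different elements of $G$, or of $S$, as different strings). The family is assumed efficient: for instances that occur at parameter $\ell$ all these strings have length at most a polynomial in $\ell$; $\Phi$ is computable in polynomial time; and elements of $G$ can be sampled in probabilistic polynomial time with a distribution at statistical distance at most $\varepsilon(\ell)$ from uniform, for a negligible $\varepsilon$. A function $\varepsilon$ is negligible if $\ell^c\varepsilon(\ell)\to0$ for all $c$. **Indistinguishability.** In a protocol for $n$ users $\mathcal U_1,\dots,\mathcal U_n$ the private elements $g_1,\dots,g_n\in G$ are independent and uniform. A key $K\in S$ derived in the protocol is \emph{indistinguishable in polynomial time from a random value} if for every probabilistic polynomial-time algorithm $A$ with output in $\{0,1\}$ the quantity $$\bigl|\Pr[A(1^\ell,\text{instance},s,\text{messages},K)=1]-\Pr[A(1^\ell,\text{instance},s,\text{messages},r)=1]\bigr|$$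 is negligible in $\ell$, where the messages are all the values exchanged between users, $r\in S$ is uniform and independent of everything else, and the probability is over the instance, the $g_i$, $r$ and the coins of $A$. **Protocols** (all start from the public $s$). * *Two-party Diffie–Hellman:* the messages are $\Phi(g_1,s)$ and $\Phi(g_2,s)$; the key is $\Phi(g_1,\Phi(g_2,s))$. * *GSAP-1:* let $C_0=s$ and $C_i=\Phi(g_i,C_{i-1})$. For $i=1,\dots,n-1$, $\mathcal U_i$ sends $\{C_1,\dots,C_i\}$ to $\mathcal U_{i+1}$. Then for $k=n,\dots,2$, $\mathcal U_k$ sends $\{f_1^k,\dots,f_{k-1}^k\}$ to $\mathcal U_{k-1}$, where $f_j^n=\Phi(g_n,C_{j-1})$ and $f_j^k=\Phi(g_k,f_j^{k+1})$ for $k<n$. The key is computed by $\mathcal U_n$ as $\Phi(g_n,C_{n-1})$ and by $\mathcal U_k$, $k<n$, as $\Phi(g_k,f_k^{k+1})$. * *GSAP-2:* let $C_0^0=s$, $C_1^1=\Phi(g_1,s)$ and, for $i\ge2$, $C_1^i=\Phi(g_i,C_{i-2}^{i-2})$ and $C_j^i=\Phi(g_i,C_{j-1}^{i-1})$ for $2\le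 j\le i$. For $i=1,\dots,n-1$, $\mathcal U_i$ sends $\{C_{i-1}^{i-1},C_1^i,\dots,C_i^i\}$ to $\mathcal U_{i+1}$. Then $\mathcal U_n$ broadcasts $\{f_1^n,\dots,f_n^n\}$, where $f_i^n=\Phi(g_n,C_{n-1-i}^{n-1})$ for $i\le n-2$, $f_{n-1}^n=\Phi(g_n,C_{n-2}^{n-2})$ and $f_n^n=C_{n-1}^{n-1}$. $\mathcal U_k$ computes the key as $\Phi(g_k,f_k^n)$. * *GSAP-3* (only if every $G$ is a group): let $C_0=s$ and $C_i=\Phi(g_i,C_{i-1})$. The values $C_1,\dots,C_{n-2}$ are sent along the chain of users and $\mathcal U_{n-1}$ broadcasts $C_{n-1}$. Each $\mathcal U_i$, $i<n$, sends $D_i=\Phi(g_i^{-1},C_{n-1})$ to $\mathcal U_n$, who broadcasts $\{\Phi(g_n,D_1),\dots,\Phi(g_n,D_{n-1}),C_{n-1}\}$. The key is computed by $\mathcal U_n$ as $\Phi(g_n,C_{n-1})$ and by $\mathcal U_k$, $k<n$, as $\Phi(g_k,\Phi(g_n,D_k))$. **Theorem.** Let an efficient action family be given in which every action $\Phi$ is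 transitive, i.e. for all $x,y\in S$ there is $g\in G$ with $\Phi(g,x)=y$. Suppose that the key of the two-party Diffie–Hellman protocol induced by $\Phi$ is indistinguishable in polynomial time from a random value. Then for every fixed number $n\ge2$ of users, the group key that any of the users $\mathcal U_1,\dots,\mathcal U_n$ derives in GSAP-1 or GSAP-2, and, if every $G$ is a group, in GSAP-3, is indistinguishable in polynomial time from a random value, given only the values exchanged between users during the protocol. -/

import Mathlib

/-! ## A probabilistic machine model with a step count -/

/-- The data that programs work on: finite binary trees. -/
inductive Data : Type
  | nil : Data
  | cons : Data → Data → Data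

namespace Data

/-- The number of nodes. -/
def size : Data → ℕ
  | nil => 1
  | cons a b => a.size + b.size + 1

/-- A bit; `1` is a non-empty tree. -/
def ofBool : Bool → Data
  | false => nil
  | true => cons nil nil

/-- A list of data. -/
def ofList : List Data → Data
  | [] => nil
  | a :: l => cons a (ofList l)

/-- A bit string. -/
def ofBits (w : List Bool) : Data := ofList (w.map ofBool)

/-- The number `k`, written in unary. -/
def unary (k : ℕ) : Data := ofList (List.replicate k nil)

end Data

/-- Programs of a first-order while language on binary trees, with a coin-flip instruction. -/
inductive Prog : Type
  /-- return the empty tree -/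
  | nil : Prog
  /-- return the argument -/
  | id : Prog
  /-- left subtree -/
  | fst : Prog
  /-- right subtree -/
  | snd : Prog
  /-- return a fresh uniformly random bit -/
  | flip : Prog
  /-- run both programs on the argument (with independent coins) and return the pair of outputs -/
  | pair : Prog → Prog → Prog
  /-- `comp f g`: run `g`, then run `f` on its output -/
  | comp : Prog → Prog → Prog
  /-- `cond f g` on `cons a b`: run `f` on `b` if `a` is empty, run `g` on `b` otherwise -/
  | cond : Prog → Prog → Prog
  /-- `loop f` on `cons a b`: return `b` if `a` is empty; otherwise run `f` on `b` and
  repeat with its output -/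
  | loop : Prog → Prog

/-- `HaltsIn p x μ t`: whatever the coins are, the program `p` halts on input `x` after at most `t`
steps, and its output has the law `μ`. An instruction that reads, copies or discards its argument
`x` is charged `x.size` steps, so that the size of an output never exceeds the number of steps, and
the model is polynomially equivalent to probabilistic Turing machines. -/
inductive HaltsIn : Prog → Data → PMF Data → ℕ → Prop
  | nil (x : Data) : HaltsIn .nil x (PMF.pure .nil) x.size
  | id (x : Data) : HaltsIn .id x (PMF.pure x) x.size
  | fst_nil : HaltsIn .fst .nil (PMF.pure .nil) 1
  | fst_cons (a b : Data) : HaltsIn .fst (.cons a b) (PMF.pure a) (Data.cons a b).size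
  | snd_nil : HaltsIn .snd .nil (PMF.pure .nil) 1
  | snd_cons (a b : Data) : HaltsIn .snd (.cons a b) (PMF.pure b) (Data.cons a b).size
  | flip (x : Data) :
      HaltsIn .flip x ((PMF.uniformOfFintype Bool).map Data.ofBool) (x.size + 3)
  | pair {f g : Prog} {x : Data} {μ ν : PMF Data} {t t' : ℕ} :
      HaltsIn f x μ t → HaltsIn g x ν t' →
      HaltsIn (.pair f g) x (μ.bind fun a => ν.map fun b => Data.cons a b) (t + t' + x.size)
  | comp {f g : Prog} {x : Data} {μ : PMF Data} {ν : Data → PMF Data} {t t' : ℕ} :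
      HaltsIn g x μ t → (∀ y ∈ μ.support, HaltsIn f y (ν y) t') →
      HaltsIn (.comp f g) x (μ.bind ν) (t + t' + 1)
  | cond_nil {f g : Prog} : HaltsIn (.cond f g) .nil (PMF.pure .nil) 1
  | cond_false {f g : Prog} {b : Data} {μ : PMF Data} {t : ℕ} :
      HaltsIn f b μ t →
      HaltsIn (.cond f g) (.cons .nil b) μ (t + (Data.cons .nil b).size)
  | cond_true {f g : Prog} {a a' b : Data} {μ : PMF Data} {t : ℕ} :
      HaltsIn g b μ t →
      HaltsIn (.cond f g) (.cons (.cons a a') b) μ (t + (Data.cons (.cons a a') b).size)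
  | loop_nil {f : Prog} : HaltsIn (.loop f) .nil (PMF.pure .nil) 1
  | loop_done {f : Prog} {b : Data} :
      HaltsIn (.loop f) (.cons .nil b) (PMF.pure b) (Data.cons .nil b).size
  | loop_step {f : Prog} {a a' b : Data} {μ : PMF Data} {ν : Data → PMF Data} {t t' : ℕ} :
      HaltsIn f b μ t → (∀ y ∈ μ.support, HaltsIn (.loop f) y (ν y) t') →
      HaltsIn (.loop f) (.cons (.cons a a') b) (μ.bind ν)
        (t + t' + (Data.cons (.cons a a') b).size)
  | mono {p : Prog} {x : Data} {μ : PMF Data} {t t' : ℕ} :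
      HaltsIn p x μ t → t ≤ t' → HaltsIn p x μ t'

/-- `κ` is the input-output behaviour of a probabilistic polynomial-time algorithm: one program
halts on every input `x`, whatever the coins are, after a number of steps that is polynomial in the
size of `x`, and its output has the law `κ x`. -/
def PPT (κ : Data → PMF Data) : Prop :=
  ∃ (c : Prog) (p : Polynomial ℕ), ∀ x : Data, HaltsIn c x (κ x) (p.eval x.size)

/-- Functions computable in polynomial time. -/
def PolyTime (f : Data → Data) : Prop := PPT fun x => PMF.pure (f x)

/-- Negligible functions of the security parameter: `ℓ ^ c * ε ℓ → 0` for every `c`. -/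
def Negligible (ε : ℕ → ℝ) : Prop :=
  Asymptotics.SuperpolynomialDecay Filter.atTop (fun ℓ : ℕ => (ℓ : ℝ)) ε

/-- Statistical (total variation) distance. -/
noncomputable def statDist (μ ν : PMF Data) : ℝ :=
  (1 / 2) * ∑' x : Data, |(μ x).toReal - (ν x).toReal|

/-! ## Families of semigroup actions -/

/-- A family of instances, each of which consists of a finite abelian semigroup `G i`, a finite set
`S i`, an action of `G i` on `S i` and a public element `s i` of `S i`. For the security parameter
`ℓ` the instance is drawn from the law `gen ℓ` (a point mass if there is one instance for each
`ℓ`). Instances, semigroup elements and elements of the set are written as bit strings. -/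
structure ActionFamily where
  ι : Type*
  gen : ℕ → PMF ι
  G : ι → Type*
  S : ι → Type*
  [semigroupG : ∀ i, CommSemigroup (G i)]
  [action : ∀ i, SemigroupAction (G i) (S i)]
  [fintypeG : ∀ i, Fintype (G i)]
  [nonemptyG : ∀ i, Nonempty (G i)]
  [fintypeS : ∀ i, Fintype (S i)]
  s : ∀ i, S i
  descr : ι → List Bool
  encG : ∀ i, G i → List Bool
  encS : ∀ i, S i → List Bool
  encG_injective : ∀ i, Function.Injective (encG i)
  encS_injective : ∀ i, Function.Injective (encS i)

namespace ActionFamily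

attribute [instance] semigroupG action fintypeG nonemptyG fintypeS

instance (F : ActionFamily) (i : F.ι) : Nonempty (F.S i) := ⟨F.s i⟩

/-- Every action of the family is transitive. -/
def Transitive (F : ActionFamily) : Prop :=
  ∀ (i : F.ι) (x y : F.S i), ∃ g : F.G i, g • x = y

/-- The honest users can work in polynomial time: elements have polynomially long descriptions,
the action is computable in polynomial time, and private elements can be drawn in probabilistic
polynomial time, uniformly up to a negligible statistical error. -/
structure Efficient (F : ActionFamily) : Prop where
  length : ∃ p : Polynomial ℕ, ∀ ℓ, ∀ i ∈ (F.gen ℓ).support,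
    (F.descr i).length ≤ p.eval ℓ ∧ (∀ g, (F.encG i g).length ≤ p.eval ℓ) ∧
      ∀ x, (F.encS i x).length ≤ p.eval ℓ
  act : ∃ f : Data → Data, PolyTime f ∧
    ∀ ℓ, ∀ i ∈ (F.gen ℓ).support, ∀ (g : F.G i) (x : F.S i),
      f (Data.ofList [Data.unary ℓ, Data.ofBits (F.descr i), Data.ofBits (F.encG i g),
        Data.ofBits (F.encS i x)]) = Data.ofBits (F.encS i (g • x))
  sample : ∃ (κ : Data → PMF Data) (ε : ℕ → ℝ), PPT κ ∧ Negligible ε ∧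
    ∀ ℓ, ∀ i ∈ (F.gen ℓ).support,
      statDist (κ (Data.ofList [Data.unary ℓ, Data.ofBits (F.descr i)]))
        ((PMF.uniformOfFintype (F.G i)).map fun g => Data.ofBits (F.encG i g)) ≤ ε ℓ

end ActionFamily

/-! ## The protocols

The user `U_j`, `j = 1, …, n`, holds the private element `g j`. A transcript is the list of the
messages that are sent, each of which is a list of elements of the set. -/

section Protocols

variable {G S : Type*} [CommSemigroup G] [SemigroupAction G S]

/-- Two-party Diffie–Hellman: the public keys. -/
def dhTranscript (g : ℕ → G) (s : S) : List (List S) := [[g 1 • s], [g 2 • s]]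

/-- Two-party Diffie–Hellman: the common key. -/
def dhKey (g : ℕ → G) (s : S) : S := g 1 • (g 2 • s)

/-- `C_0 = s` and `C_i = Φ(g_i, C_{i-1})` (in GSAP-1 and GSAP-3). -/
def chain (g : ℕ → G) (s : S) : ℕ → S
  | 0 => s
  | i + 1 => g (i + 1) • chain g s i

/-- `f_j^{n-d}` of GSAP-1, by recursion on `d`: `f_j^n = Φ(g_n, C_{j-1})` and
`f_j^k = Φ(g_k, f_j^{k+1})`. -/
def gsap1Aux (n : ℕ) (g : ℕ → G) (s : S) (j : ℕ) : ℕ → S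
  | 0 => g n • chain g s (j - 1)
  | d + 1 => g (n - (d + 1)) • gsap1Aux n g s j d

/-- `f_j^k` of GSAP-1, for `1 ≤ j < k ≤ n`. -/
def gsap1F (n : ℕ) (g : ℕ → G) (s : S) (k j : ℕ) : S := gsap1Aux n g s j (n - k)

/-- GSAP-1: `U_i` sends `C_1, …, C_i` to `U_{i+1}` for `i = 1, …, n-1`, and then `U_k` sends
`f_1^k, …, f_{k-1}^k` to `U_{k-1}` for `k = n, …, 2`. -/
def gsap1Transcript (n : ℕ) (g : ℕ → G) (s : S) : List (List S) :=
  ((List.range' 1 (n - 1)).map fun i => (List.range' 1 i).map fun j => chain g s j) ++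
  (List.range' 2 (n - 1)).reverse.map fun k => (List.range' 1 (k - 1)).map fun j => gsap1F n g s k j

/-- The key that `U_k` computes in GSAP-1. -/
def gsap1Key (n : ℕ) (g : ℕ → G) (s : S) (k : ℕ) : S :=
  if k = n then g n • chain g s (n - 1) else g k • gsap1F n g s (k + 1) k

/-- `C_j^i` of GSAP-2 (first argument `i`), for `i = j = 0` and `1 ≤ j ≤ i`. -/
def gsap2C (g : ℕ → G) (s : S) : ℕ → ℕ → S
  | 0, _ => s
  | 1, _ => g 1 • s
  | i + 2, j => if j ≤ 1 then g (i + 2) • gsap2C g s i i else g (i + 2) • gsap2C g s (i + 1) (j - 1)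

/-- `f_i^n` of GSAP-2, for `1 ≤ i ≤ n`. -/
def gsap2F (n : ℕ) (g : ℕ → G) (s : S) (i : ℕ) : S :=
  if i = n then gsap2C g s (n - 1) (n - 1)
  else if i = n - 1 then g n • gsap2C g s (n - 2) (n - 2)
  else g n • gsap2C g s (n - 1) (n - 1 - i)

/-- GSAP-2: `U_i` sends `C_{i-1}^{i-1}, C_1^i, …, C_i^i` to `U_{i+1}` for `i = 1, …, n-1`, and then
`U_n` broadcasts `f_1^n, …, f_n^n`. -/
def gsap2Transcript (n : ℕ) (g : ℕ → G) (s : S) : List (List S) :=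
  ((List.range' 1 (n - 1)).map fun i =>
    gsap2C g s (i - 1) (i - 1) :: (List.range' 1 i).map fun j => gsap2C g s i j) ++
  [(List.range' 1 n).map fun i => gsap2F n g s i]

/-- The key that `U_k` computes in GSAP-2. -/
def gsap2Key (n : ℕ) (g : ℕ → G) (s : S) (k : ℕ) : S := g k • gsap2F n g s k

/-- The abelian semigroup `G` is a group, in which `inv` is the inversion. -/
def IsGroupInversion (inv : G → G) : Prop :=
  ∃ e : G, (∀ g, e * g = g) ∧ ∀ g, inv g * g = e

/-- `D_i = Φ(g_i⁻¹, C_{n-1})` of GSAP-3. -/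
def gsap3D (inv : G → G) (n : ℕ) (g : ℕ → G) (s : S) (i : ℕ) : S := inv (g i) • chain g s (n - 1)

/-- GSAP-3: `C_1, …, C_{n-2}` are sent along the chain of users, `U_{n-1}` broadcasts `C_{n-1}`,
every `U_i` with `i < n` sends `D_i` to `U_n`, and `U_n` broadcasts
`Φ(g_n, D_1), …, Φ(g_n, D_{n-1}), C_{n-1}`. -/
def gsap3Transcript (inv : G → G) (n : ℕ) (g : ℕ → G) (s : S) : List (List S) :=
  ((List.range' 1 (n - 1)).map fun i => [chain g s i]) ++
  ((List.range' 1 (n - 1)).map fun i => [gsap3D inv n g s i]) ++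
  [((List.range' 1 (n - 1)).map fun i => g n • gsap3D inv n g s i) ++ [chain g s (n - 1)]]

/-- The key that `U_k` computes in GSAP-3. -/
def gsap3Key (inv : G → G) (n : ℕ) (g : ℕ → G) (s : S) (k : ℕ) : S :=
  if k = n then g n • chain g s (n - 1) else g k • (g n • gsap3D inv n g s k)

end Protocols

/-! ## Indistinguishability from random -/

namespace ActionFamily

variable (F : ActionFamily)

/-- The private elements, numbered from `1` to `n` (other indices are never used). -/
noncomputable def privateKeys {n : ℕ} {i : F.ι} (g : Fin n → F.G i) (j : ℕ) : F.G i :=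
  if h : j - 1 < n then g ⟨j - 1, h⟩ else Classical.arbitrary (F.G i)

/-- What an adversary is given: the security parameter in unary, the instance, its public element,
a transcript, and a challenge value. -/
def challenge (ℓ : ℕ) (i : F.ι) (m : List (List (F.S i))) (v : F.S i) : Data :=
  Data.ofList [Data.unary ℓ, Data.ofBits (F.descr i), Data.ofBits (F.encS i (F.s i)),
    Data.ofList (m.map fun l => Data.ofList (l.map fun x => Data.ofBits (F.encS i x))),
    Data.ofBits (F.encS i v)]

/-- The output law of the adversary `A` if the challenge is the key. The `n` private elements are
independent and uniform. -/
noncomputable def realGame (n : ℕ) (T : ∀ i, (ℕ → F.G i) → List (List (F.S i)))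
    (K : ∀ i, (ℕ → F.G i) → F.S i) (A : Data → PMF Data) (ℓ : ℕ) : PMF Data :=
  (F.gen ℓ).bind fun i =>
    (PMF.uniformOfFintype (Fin n → F.G i)).bind fun g =>
      A (F.challenge ℓ i (T i (F.privateKeys g)) (K i (F.privateKeys g)))

/-- The output law of the adversary `A` if the challenge is an independent uniform element. -/
noncomputable def randomGame (n : ℕ) (T : ∀ i, (ℕ → F.G i) → List (List (F.S i)))
    (A : Data → PMF Data) (ℓ : ℕ) : PMF Data :=
  (F.gen ℓ).bind fun i =>
    (PMF.uniformOfFintype (Fin n → F.G i)).bind fun g =>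
      (PMF.uniformOfFintype (F.S i)).bind fun r =>
        A (F.challenge ℓ i (T i (F.privateKeys g)) r)

/-- The key `K` of an `n`-party protocol is indistinguishable in polynomial time from a random
value, given the transcript `T`: every probabilistic polynomial-time adversary outputs `1` with
probabilities that differ by a negligible amount in the two games. -/
def KeyIndistinguishable (n : ℕ) (T : ∀ i, (ℕ → F.G i) → List (List (F.S i)))
    (K : ∀ i, (ℕ → F.G i) → F.S i) : Prop :=
  ∀ A : Data → PMF Data, PPT A → Negligible fun ℓ =>
    |(F.realGame n T K A ℓ (Data.ofBool true)).toReal -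
      (F.randomGame n T A ℓ (Data.ofBool true)).toReal|

end ActionFamily

/-! ## Closure properties of probabilistic polynomial time -/

namespace Data

/-! Transitivity and commutativity turn `S` into an abelian group with identity `s` on which each
`g` acts as translation by its public key `g • s` (`exists_commGroup_of_transitive`). Every value in
the three protocols is then a product of public keys over a set of users: messages belong to proper
subsets, the key to the full set. It therefore suffices that the full product looks random given the
products over all proper subsets (`word_univ_indist`). There are `2 ^ n` of these, a constant
number.

The Diffie–Hellman assumption trades `g a • g b • s` for a uniform `r` inside any family of such
products, because an adversary can simulate all users other than `a` and `b` (`wordView_indist`).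
The simulation only samples private elements and acts with them; multiplication and inversion in `S`
are never computed, and serve the analysis alone.

A uniform private element need not move `s` to a uniform point, since the fibres of `g ↦ g • s` may
differ in size. So `r` cannot be read as the public key of a merged user. Instead the assumption is
applied backwards, which turns `r` into the Diffie–Hellman key of two fresh auxiliary users. By
induction on a set `P` of users, `hybrid` replaces the product over `P`, wherever it divides a
product, by such a pair. Taking `P` to be everybody and applying the assumption once more makes the
key uniform. -/

theorem size_pos (x : Data) : 0 < x.size := by
  cases x <;> simp [size]

/-- The left subtree. -/
def left : Data → Data
  | nil => nil
  | cons a _ => a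

/-- The right subtree. -/
def right : Data → Data
  | nil => nil
  | cons _ b => b

/-- The `k`-th entry of a list. -/
def nth : ℕ → Data → Data
  | 0, x => x.left
  | k + 1, x => nth k x.right

@[simp] theorem left_cons (a b : Data) : (cons a b).left = a := rfl

@[simp] theorem right_cons (a b : Data) : (cons a b).right = b := rfl

@[simp] theorem nth_succ_ofList (k : ℕ) (a : Data) (l : List Data) :
    nth (k + 1) (ofList (a :: l)) = nth k (ofList l) := rfl

theorem nth_ofList (l : List Data) (k : ℕ) (hk : k < l.length) : nth k (ofList l) = l[k] := by
  induction l generalizing k with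
  | nil => simp at hk
  | cons a l ih =>
    cases k with
    | zero => rfl
    | succ k => simpa using ih k (by simpa using hk)

end Data

theorem Polynomial.eval_mono_nat (p : Polynomial ℕ) {a b : ℕ} (h : a ≤ b) :
    p.eval a ≤ p.eval b := by
  rw [Polynomial.eval_eq_sum_range, Polynomial.eval_eq_sum_range]
  gcongr

/-- This bounds the input of the second program in a composition, so that polynomial running times
compose. -/
theorem HaltsIn.size_le {p : Prog} {x : Data} {μ : PMF Data} {t : ℕ} (h : HaltsIn p x μ t) :
    ∀ y ∈ μ.support, y.size ≤ t := by
  induction h with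
  | nil x => simpa [Data.size] using Nat.succ_le_of_lt x.size_pos
  | id x => simp
  | fst_nil => simp [Data.size]
  | fst_cons a b => simp [Data.size]; omega
  | snd_nil => simp [Data.size]
  | snd_cons a b => simp [Data.size]; omega
  | flip x =>
    intro y hy
    rw [PMF.mem_support_map_iff] at hy
    obtain ⟨b, -, rfl⟩ := hy
    cases b <;> simp [Data.ofBool, Data.size]
  | @pair f g x μ ν t t' _ _ ihf ihg =>
    intro y hy
    rw [PMF.mem_support_bind_iff] at hy
    obtain ⟨a, ha, hy⟩ := hy
    rw [PMF.mem_support_map_iff] at hy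
    obtain ⟨b, hb, rfl⟩ := hy
    have h1 := ihf a ha
    have h2 := ihg b hb
    have h3 := x.size_pos
    simp only [Data.size]
    omega
  | comp _ _ ih1 ih2 =>
    intro y hy
    rw [PMF.mem_support_bind_iff] at hy
    obtain ⟨a, ha, hy⟩ := hy
    have := ih2 a ha y hy
    omega
  | cond_nil => simp [Data.size]
  | cond_false _ ih => intro y hy; have := ih y hy; omega
  | cond_true _ ih => intro y hy; have := ih y hy; omega
  | loop_nil => simp [Data.size]
  | loop_done => simp [Data.size]; omega
  | loop_step _ _ ih1 ih2 =>
    intro y hy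
    rw [PMF.mem_support_bind_iff] at hy
    obtain ⟨a, ha, hy⟩ := hy
    have := ih2 a ha y hy
    omega
  | mono _ hle ih => intro y hy; exact (ih y hy).trans hle

theorem PPT.bind {κ₁ κ₂ : Data → PMF Data} (h₁ : PPT κ₁) (h₂ : PPT κ₂) :
    PPT fun x => (κ₁ x).bind κ₂ := by
  obtain ⟨c₁, p₁, h₁⟩ := h₁
  obtain ⟨c₂, p₂, h₂⟩ := h₂
  refine ⟨.comp c₂ c₁, p₁ + p₂.comp p₁ + 1, fun x => ?_⟩
  have h := HaltsIn.comp (f := c₂) (ν := κ₂) (t' := p₂.eval (p₁.eval x.size)) (h₁ x)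
    fun y hy => (h₂ y).mono (p₂.eval_mono_nat ((h₁ x).size_le y hy))
  simpa [Polynomial.eval_comp] using h

theorem PPT.pair {κ₁ κ₂ : Data → PMF Data} (h₁ : PPT κ₁) (h₂ : PPT κ₂) :
    PPT fun x => (κ₁ x).bind fun a => (κ₂ x).map fun b => Data.cons a b := by
  obtain ⟨c₁, p₁, h₁⟩ := h₁
  obtain ⟨c₂, p₂, h₂⟩ := h₂
  refine ⟨.pair c₁ c₂, p₁ + p₂ + Polynomial.X, fun x => ?_⟩
  simpa using HaltsIn.pair (h₁ x) (h₂ x)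

theorem PPT.comp_polyTime {κ : Data → PMF Data} {f : Data → Data} (h : PPT κ) (hf : PolyTime f) :
    PPT fun x => κ (f x) := by
  simpa using PPT.bind hf h

namespace PolyTime

theorem id : PolyTime fun x => x :=
  ⟨.id, Polynomial.X, fun x => by simpa using HaltsIn.id x⟩

theorem nil : PolyTime fun _ => Data.nil :=
  ⟨.nil, Polynomial.X, fun x => by simpa using HaltsIn.nil x⟩

theorem comp {f g : Data → Data} (hf : PolyTime f) (hg : PolyTime g) :
    PolyTime fun x => f (g x) :=
  PPT.comp_polyTime (κ := fun y => PMF.pure (f y)) hf hg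

theorem cons {f g : Data → Data} (hf : PolyTime f) (hg : PolyTime g) :
    PolyTime fun x => Data.cons (f x) (g x) := by
  simpa [PolyTime, PMF.pure_map] using PPT.pair hf hg

theorem left : PolyTime Data.left := by
  refine ⟨.fst, Polynomial.X, fun x => ?_⟩
  cases x with
  | nil => simpa [Data.size, Data.left] using HaltsIn.fst_nil
  | cons a b => simpa using HaltsIn.fst_cons a b

theorem right : PolyTime Data.right := by
  refine ⟨.snd, Polynomial.X, fun x => ?_⟩
  cases x with
  | nil => simpa [Data.size, Data.right] using HaltsIn.snd_nil
  | cons a b => simpa using HaltsIn.snd_cons a b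

theorem nth (k : ℕ) : PolyTime (Data.nth k) := by
  induction k with
  | zero => exact left
  | succ k ih => exact ih.comp right

theorem ofList_map {α : Type*} (l : List α) {f : α → Data → Data} (hf : ∀ a, PolyTime (f a)) :
    PolyTime fun x => Data.ofList (l.map fun a => f a x) := by
  induction l with
  | nil => exact nil
  | cons a l ih => exact (hf a).cons ih

end PolyTime

/-! ## Uniform laws and comparison of output probabilities -/

namespace PMF

theorem summable_toReal {α : Type*} (p : PMF α) : Summable fun a => (p a).toReal :=
  ENNReal.summable_toReal p.tsum_coe_ne_top

theorem tsum_toReal {α : Type*} (p : PMF α) : ∑' a, (p a).toReal = 1 := by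
  rw [← ENNReal.tsum_toReal_eq fun a => p.apply_ne_top a, p.tsum_coe, ENNReal.toReal_one]

theorem toReal_apply_le_one {α : Type*} (p : PMF α) (a : α) : (p a).toReal ≤ 1 :=
  ENNReal.toReal_le_of_le_ofReal zero_le_one (by simpa using p.coe_le_one a)

theorem summable_toReal_mul {α β : Type*} (p : PMF α) (f : α → PMF β) (b : β) :
    Summable fun a => (p a).toReal * (f a b).toReal :=
  p.summable_toReal.of_nonneg_of_le (fun _ => by positivity) fun a =>
    mul_le_of_le_one_right ENNReal.toReal_nonneg ((f a).toReal_apply_le_one b)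

theorem toReal_bind_apply {α β : Type*} (p : PMF α) (f : α → PMF β) (b : β) :
    (p.bind f b).toReal = ∑' a, (p a).toReal * (f a b).toReal := by
  rw [bind_apply, ENNReal.tsum_toReal_eq]
  · simp [ENNReal.toReal_mul]
  · exact fun a => ENNReal.mul_ne_top (p.apply_ne_top a) ((f a).apply_ne_top b)

theorem abs_tsum_sub_le {α : Type*} {f g h : α → ℝ} (hf : Summable f) (hg : Summable g)
    (hh : Summable h) (hle : ∀ a, |f a - g a| ≤ h a) : |∑' a, f a - ∑' a, g a| ≤ ∑' a, h a := by
  rw [← hf.tsum_sub hg, abs_le, ← tsum_neg]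
  exact ⟨hh.neg.tsum_le_tsum (fun a => (abs_le.1 (hle a)).1) (hf.sub hg),
    (hf.sub hg).tsum_le_tsum (fun a => (abs_le.1 (hle a)).2) hh⟩

/-- Randomized post-processing cannot amplify the `L¹` distance, which is twice the statistical
distance. -/
theorem abs_bind_sub_bind_le_tsum {α β : Type*} (p q : PMF α) (f : α → PMF β) (b : β) :
    |(p.bind f b).toReal - (q.bind f b).toReal| ≤ ∑' a, |(p a).toReal - (q a).toReal| := by
  have hs : Summable fun a => |(p a).toReal - (q a).toReal| :=
    (p.summable_toReal.sub q.summable_toReal).abs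
  have hle : ∀ a, |(p a).toReal * (f a b).toReal - (q a).toReal * (f a b).toReal| ≤
      |(p a).toReal - (q a).toReal| := fun a => by
    rw [← sub_mul, abs_mul, abs_of_nonneg (a := (f a b).toReal) ENNReal.toReal_nonneg]
    exact mul_le_of_le_one_right (abs_nonneg _) ((f a).toReal_apply_le_one b)
  rw [toReal_bind_apply, toReal_bind_apply]
  exact abs_tsum_sub_le (p.summable_toReal_mul f b) (q.summable_toReal_mul f b) hs hle

theorem abs_bind_sub_bind_le {α β : Type*} (p : PMF α) (f f' : α → PMF β) (b : β) (c : ℝ)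
    (h : ∀ a ∈ p.support, |(f a b).toReal - (f' a b).toReal| ≤ c) :
    |(p.bind f b).toReal - (p.bind f' b).toReal| ≤ c := by
  have hle : ∀ a, |(p a).toReal * (f a b).toReal - (p a).toReal * (f' a b).toReal| ≤
      (p a).toReal * c := fun a => by
    rw [← mul_sub, abs_mul, abs_of_nonneg (a := (p a).toReal) ENNReal.toReal_nonneg]
    by_cases ha : p a = 0
    · simp [ha]
    · exact mul_le_mul_of_nonneg_left (h a ((p.mem_support_iff a).2 ha)) ENNReal.toReal_nonneg
  rw [toReal_bind_apply, toReal_bind_apply]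
  refine (abs_tsum_sub_le (p.summable_toReal_mul f b) (p.summable_toReal_mul f' b)
    (p.summable_toReal.mul_right c) hle).trans_eq ?_
  rw [tsum_mul_right, p.tsum_toReal, one_mul]

theorem bind_congr_support {α β : Type*} (p : PMF α) {f f' : α → PMF β}
    (h : ∀ a ∈ p.support, f a = f' a) : p.bind f = p.bind f' := by
  ext b
  rw [bind_apply, bind_apply]
  congr 1 with a
  by_cases ha : p a = 0
  · simp [ha]
  · rw [h a ((p.mem_support_iff a).2 ha)]

variable {α β γ : Type*} [Fintype α] [Nonempty α] [Fintype β] [Nonempty β]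

theorem uniformOfFintype_bind_equiv (e : α ≃ α) (K : α → PMF γ) :
    ((uniformOfFintype α).bind fun a => K (e a)) = (uniformOfFintype α).bind K := by
  ext c
  simp only [bind_apply, uniformOfFintype_apply]
  exact e.tsum_eq fun a => (Fintype.card α : ENNReal)⁻¹ * K a c

theorem uniformOfFintype_bind_uniformOfFintype (K : α → β → PMF γ) :
    ((uniformOfFintype α).bind fun a => (uniformOfFintype β).bind (K a)) =
      (uniformOfFintype (α × β)).bind fun x => K x.1 x.2 := by
  ext c
  simp only [bind_apply, uniformOfFintype_apply, ← ENNReal.tsum_mul_left,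
    Fintype.card_prod, Nat.cast_mul, ENNReal.tsum_prod']
  congr! 4 with a b
  rw [← mul_assoc, ENNReal.mul_inv] <;> simp

theorem map_uniformOfFintype_of_fiber (f : α → β)
    (h : ∀ b b', Nonempty ({a // f a = b} ≃ {a // f a = b'})) :
    (uniformOfFintype α).map f = uniformOfFintype β := by
  classical
  have key : ∀ b, (uniformOfFintype α).map f b =
      (Fintype.card {a // f a = b} : ENNReal) / Fintype.card α := fun b => by
    rw [← toOuterMeasure_apply_singleton, toOuterMeasure_map_apply,
      toOuterMeasure_uniformOfFintype_apply]
    rfl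
  have hconst : ∀ b b', (uniformOfFintype α).map f b = (uniformOfFintype α).map f b' :=
    fun b b' => by rw [key, key, Fintype.card_congr (h b b').some]
  ext b
  have hsum := ((uniformOfFintype α).map f).tsum_coe
  rw [tsum_fintype, Finset.sum_congr rfl fun b' _ => hconst b' b, Finset.sum_const,
    Finset.card_univ, nsmul_eq_mul] at hsum
  rw [uniformOfFintype_apply]
  exact ENNReal.eq_inv_of_mul_eq_one_left (by rw [mul_comm]; exact hsum)

/-- The coordinates of a uniform vector at different places form a uniform vector. -/
theorem uniformOfFintype_map_comp_injective {V W G : Type*} [Fintype V] [DecidableEq V] [Fintype W]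
    [DecidableEq W] [Fintype G] [Nonempty G] (e : W → V) (he : Function.Injective e) :
    ((uniformOfFintype (V → G)).map fun g => g ∘ e) = uniformOfFintype (W → G) := by
  -- Overwriting the coordinates in the range of `e` gives mutually inverse maps between any two
  -- fibres.
  have aux : ∀ h h' : W → G, ∀ g : V → G, g ∘ e = h →
      Function.extend e h (Function.extend e h' g) = g := by
    rintro h h' g rfl
    funext x
    by_cases hx : ∃ w, e w = x
    · obtain ⟨w, rfl⟩ := hx
      rw [he.extend_apply, Function.comp_apply]
    · rw [Function.extend_apply' _ _ _ hx, Function.extend_apply' _ _ _ hx]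
  refine map_uniformOfFintype_of_fiber _ fun h h' => ⟨⟨
    fun g => ⟨Function.extend e h' g.1, funext fun _ => he.extend_apply _ _ _⟩,
    fun g => ⟨Function.extend e h g.1, funext fun _ => he.extend_apply _ _ _⟩,
    fun g => Subtype.ext (aux h h' g.1 g.2), fun g => Subtype.ext (aux h' h g.1 g.2)⟩⟩

/-- Drawing a coordinate of a uniform vector afresh does not change the law. -/
theorem uniformOfFintype_bind_update {V G : Type*} [Fintype V] [DecidableEq V]
    [Fintype G] [Nonempty G] (v : V) (K : (V → G) → G → PMF γ) :
    ((uniformOfFintype (V → G)).bind fun g => (uniformOfFintype G).bind fun h =>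
      K (Function.update g v h) h) = (uniformOfFintype (V → G)).bind fun g => K g (g v) := by
  -- Swapping the coordinate at `v` with the fresh element permutes the product, hence preserves the
  -- uniform law.
  have hinv : Function.Involutive
      fun x : (V → G) × G => (Function.update x.1 v x.2, x.1 v) := fun x => by simp
  rw [uniformOfFintype_bind_uniformOfFintype fun g h => K (Function.update g v h) h]
  have h := uniformOfFintype_bind_equiv (hinv.toPerm _) fun x => K x.1 (x.1 v)
  simp only [Function.Involutive.coe_toPerm, Function.update_self] at h
  rw [h, ← uniformOfFintype_bind_uniformOfFintype fun (g : V → G) (_ : G) => K g (g v)]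
  simp

end PMF

/-! ## Negligible functions -/

namespace Negligible

theorem zero : Negligible fun _ => 0 := Asymptotics.superpolynomialDecay_zero _ _

theorem add {ε δ : ℕ → ℝ} (hε : Negligible ε) (hδ : Negligible δ) :
    Negligible fun ℓ => ε ℓ + δ ℓ :=
  Asymptotics.SuperpolynomialDecay.add hε hδ

theorem of_abs_le {ε δ : ℕ → ℝ} (hε : Negligible ε) (h : ∀ ℓ, |δ ℓ| ≤ ε ℓ) : Negligible δ :=
  Asymptotics.SuperpolynomialDecay.trans_abs_le hε fun ℓ => (h ℓ).trans (le_abs_self _)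

end Negligible

/-! ## Indistinguishable views -/

namespace ActionFamily

/-- Tuples of elements of the set, indexed by `J`, that depend on private elements, indexed by `V`,
and on one uniform element of the set. -/
abbrev View (F : ActionFamily) (V J : Type) := ∀ i, (V → F.G i) → F.S i → J → F.S i

variable {F : ActionFamily} {V : Type} [Fintype V] [DecidableEq V] {J : Type} [Fintype J]
  {J' : Type} [Fintype J']

/-- The encoding of a tuple of elements of the set. -/
noncomputable def viewData (F : ActionFamily) (ℓ : ℕ) (i : F.ι) (v : J → F.S i) : Data :=
  Data.ofList (Data.unary ℓ :: Data.ofBits (F.descr i) ::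
    (Finset.univ : Finset J).toList.map fun j => Data.ofBits (F.encS i (v j)))

/-- `J` is finite and fixed, so an entry sits at a constant position; the offset 2 skips the
security parameter and the instance. -/
theorem exists_polyTime_viewData (F : ActionFamily) (j : J) :
    ∃ f : Data → Data, PolyTime f ∧ ∀ ℓ i (v : J → F.S i),
      f (F.viewData ℓ i v) = Data.ofBits (F.encS i (v j)) := by
  obtain ⟨k, hk, hkj⟩ := List.getElem_of_mem (Finset.mem_toList.2 (Finset.mem_univ j))
  refine ⟨Data.nth (k + 2), PolyTime.nth _, fun ℓ i v => ?_⟩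
  rw [viewData, Data.nth_succ_ofList, Data.nth_succ_ofList, Data.nth_ofList _ _ (by simpa using hk)]
  simp [hkj]

/-- The output law of the adversary `A` that is given a view. -/
noncomputable def viewGame (p : F.View V J) (A : Data → PMF Data) (ℓ : ℕ) : PMF Data :=
  (F.gen ℓ).bind fun i => (PMF.uniformOfFintype (V → F.G i)).bind fun g =>
    (PMF.uniformOfFintype (F.S i)).bind fun r => A (F.viewData ℓ i (p i g r))

/-- Computational indistinguishability of views. -/
def ViewIndist (p q : F.View V J) : Prop :=
  ∀ A : Data → PMF Data, PPT A → Negligible fun ℓ =>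
    |(viewGame p A ℓ (Data.ofBool true)).toReal - (viewGame q A ℓ (Data.ofBool true)).toReal|

namespace ViewIndist

theorem of_viewGame_eq {p q : F.View V J} (h : ∀ A ℓ, viewGame p A ℓ = viewGame q A ℓ) :
    ViewIndist p q := fun A _ => by simpa [h] using Negligible.zero

theorem of_eq {p q : F.View V J} (h : p = q) : ViewIndist p q :=
  of_viewGame_eq fun _ _ => by rw [h]

@[symm]
theorem symm {p q : F.View V J} (h : ViewIndist p q) : ViewIndist q p := fun A hA => by
  simpa only [abs_sub_comm] using h A hA

theorem trans {p q w : F.View V J} (h₁ : ViewIndist p q) (h₂ : ViewIndist q w) :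
    ViewIndist p w := fun A hA =>
  ((h₁ A hA).add (h₂ A hA)).of_abs_le fun ℓ => by
    rw [abs_abs]
    exact abs_sub_le _ _ _

/-- The uniform element may be replaced by its image under a permutation. -/
theorem of_perm (p : F.View V J) (τ : ∀ i, (V → F.G i) → F.S i ≃ F.S i) :
    -- The two games have equal laws, so `τ` need not be computable and may depend on the private
    -- elements.
    ViewIndist (fun i g r => p i g (τ i g r)) p :=
  of_viewGame_eq fun A ℓ => by
    unfold viewGame
    congr! 4 with i g
    exact PMF.uniformOfFintype_bind_equiv (τ i g) fun r => A (F.viewData ℓ i (p i g r))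

end ViewIndist

/-- Apply the private element with index `v` to some entries of a view. -/
def View.act (p : F.View V J) (v : V) (σ : J' → J) (b : J' → Prop) [DecidablePred b] :
    F.View V J' :=
  fun i g r j => if b j then g v • p i g r (σ j) else p i g r (σ j)

/-- The reduction `B` draws a private element for user `v`, applies it to the selected entries and
runs `A`. This is sound because the view `p` does not involve `v`. Both `B` and the error are fixed
before `p`, so one reduction serves both views that are compared. -/
theorem exists_viewGame_act (hF : F.Efficient) (v : V) (σ : J' → J) (b : J' → Prop)
    [DecidablePred b] {A : Data → PMF Data} (hA : PPT A) :
    ∃ B : Data → PMF Data, PPT B ∧ ∃ ε, Negligible ε ∧ ∀ p : F.View V J,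
      (∀ i g r h, p i (Function.update g v h) r = p i g r) → ∀ ℓ,
        |(viewGame p B ℓ (Data.ofBool true)).toReal -
          (viewGame (p.act v σ b) A ℓ (Data.ofBool true)).toReal| ≤ ε ℓ := by
  obtain ⟨φ, hφ, hact⟩ := hF.act
  obtain ⟨κ, ε, hκ, hε, hsample⟩ := hF.sample
  choose R hR hRv using fun j : J => F.exists_polyTime_viewData j
  let pre : Data → Data := fun x => Data.ofList ([0, 1].map fun k => Data.nth k x)
  have hpre : PolyTime pre := PolyTime.ofList_map _ PolyTime.nth
  -- The input here is `cons c x`, with `c` the sampled private element and `x` the given view.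
  let entry : J' → Data → Data := fun j x =>
    if b j then φ (Data.ofList ([fun x : Data => Data.nth 0 x.right, fun x => Data.nth 1 x.right,
      Data.left, fun x => R (σ j) x.right].map fun f => f x)) else R (σ j) x.right
  have hentry : ∀ j, PolyTime (entry j) := fun j => by
    have h0 := (PolyTime.nth 0).comp PolyTime.right
    have h1 := (PolyTime.nth 1).comp PolyTime.right
    have h2 := (hR (σ j)).comp PolyTime.right
    by_cases hb : b j
    · simp only [entry, hb, if_true]
      exact hφ.comp (h0.cons (h1.cons (PolyTime.left.cons (h2.cons PolyTime.nil))))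
    · simp only [entry, hb, if_false]
      exact h2
  let tr : Data → Data := fun x => Data.cons (Data.nth 0 x.right) (Data.cons (Data.nth 1 x.right)
    (Data.ofList ((Finset.univ : Finset J').toList.map fun j => entry j x)))
  have htr : PolyTime tr := ((PolyTime.nth 0).comp PolyTime.right).cons
    (((PolyTime.nth 1).comp PolyTime.right).cons (PolyTime.ofList_map _ hentry))
  refine ⟨fun x => (κ (pre x)).bind fun c => A (tr (Data.cons c x)), ?_, fun ℓ => ε ℓ + ε ℓ,
    hε.add hε, fun p hp ℓ => ?_⟩
  · have h := PPT.bind (PPT.pair (PPT.comp_polyTime hκ hpre) PolyTime.id)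
      (PPT.comp_polyTime hA htr)
    simpa [PMF.pure_map, PMF.bind_bind] using h
  have hact' : viewGame (p.act v σ b) A ℓ = (F.gen ℓ).bind fun i =>
      (PMF.uniformOfFintype (V → F.G i)).bind fun g => (PMF.uniformOfFintype (F.S i)).bind fun r =>
        ((PMF.uniformOfFintype (F.G i)).map fun h => Data.ofBits (F.encG i h)).bind fun c =>
          A (tr (Data.cons c (F.viewData ℓ i (p i g r)))) := by
    unfold viewGame
    refine PMF.bind_congr_support _ fun i hi => ?_
    have h := PMF.uniformOfFintype_bind_update v fun (g : V → F.G i) h =>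
      (PMF.uniformOfFintype (F.S i)).bind fun r =>
        A (F.viewData ℓ i fun j => if b j then h • p i g r (σ j) else p i g r (σ j))
    refine Eq.trans h.symm ?_
    congr 1 with g : 1
    rw [PMF.bind_comm]
    congr 1 with r : 1
    rw [PMF.bind_map]
    congr 1 with h : 1
    have hentry' : ∀ j, entry j (Data.cons (Data.ofBits (F.encG i h)) (F.viewData ℓ i (p i g r))) =
        Data.ofBits (F.encS i (if b j then h • p i g r (σ j) else p i g r (σ j))) := fun j => by
      by_cases hb : b j
      · simp only [entry, hb, if_true, Data.right_cons, ← hact ℓ i hi, ← hRv (σ j) ℓ i (p i g r)]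
        rfl
      · simp only [entry, hb, if_false, Data.right_cons, hRv]
    simp only [Function.comp_apply, hp, tr, hentry']
    rfl
  rw [hact']
  refine PMF.abs_bind_sub_bind_le _ _ _ _ _ fun i hi => PMF.abs_bind_sub_bind_le _ _ _ _ _
    fun g _ => PMF.abs_bind_sub_bind_le _ _ _ _ _ fun r _ => ?_
  -- The factor `1 / 2` in `statDist` is why the total error is `ε + ε`.
  refine (PMF.abs_bind_sub_bind_le_tsum _ _ _ _).trans ?_
  have h := hsample ℓ i hi
  rw [statDist] at h
  have hpre' : pre (F.viewData ℓ i (p i g r)) =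
    Data.ofList [Data.unary ℓ, Data.ofBits (F.descr i)] := rfl
  rw [hpre']
  linarith

theorem ViewIndist.act (hF : F.Efficient) {p q : F.View V J} (h : ViewIndist p q) (v : V)
    (hp : ∀ i g r h, p i (Function.update g v h) r = p i g r)
    (hq : ∀ i g r h, q i (Function.update g v h) r = q i g r)
    (σ : J' → J) (b : J' → Prop) [DecidablePred b] :
    ViewIndist (p.act v σ b) (q.act v σ b) := fun A hA => by
  obtain ⟨B, hB, ε, hε, hle⟩ := exists_viewGame_act hF v σ b hA
  refine ((hε.add (h B hB)).add hε).of_abs_le fun ℓ => ?_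
  have h1 := abs_le.1 (hle p hp ℓ)
  have h2 := abs_le.1 (hle q hq ℓ)
  have h3 := abs_le.1 (le_refl |(viewGame p B ℓ (Data.ofBool true)).toReal -
    (viewGame q B ℓ (Data.ofBool true)).toReal|)
  rw [abs_abs, abs_le]
  constructor <;> linarith [h1.1, h1.2, h2.1, h2.2, h3.1, h3.2]

end ActionFamily

/-! ## The group structure of the set -/

/-- A transitive action of an abelian semigroup on a set with a distinguished element `s` makes it an
abelian group with identity `s`, in which the action is by translations. -/
theorem exists_commGroup_of_transitive {G S : Type*} [CommSemigroup G] [SemigroupAction G S] (s : S)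
    (h : ∀ x y : S, ∃ g : G, g • x = y) :
    ∃ inst : CommGroup S, inst.one = s ∧ ∀ (g : G) (x : S), g • x = inst.mul (g • s) x := by
  choose d hd using h s
  have comm : ∀ (g g' : G) (x : S), g • g' • x = g' • g • x := fun g g' x => by
    rw [← mul_smul, mul_comm, mul_smul]
  -- Elements of `G` that agree at `s` agree everywhere: write `x = h • s` and commute `h` past
  -- them.
  have key : ∀ (g : G) (x : S), d (g • s) • x = g • x := fun g x => by
    obtain ⟨h, rfl⟩ := h s x
    rw [comm, hd, comm]
  have hcomm : ∀ x y : S, d x • y = d y • x := fun x y => by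
    conv_lhs => rw [← hd y]
    rw [comm, hd]
  have hone : ∀ x : S, d s • x = x := fun x => by rw [hcomm, hd]
  choose inv hinv using fun x : S => h x s
  let inst : CommGroup S :=
    { mul := fun x y => d x • y
      one := s
      inv := fun x => inv x • s
      mul_assoc := fun x y z => by
        change d (d x • y) • z = d x • d y • z
        rw [hcomm (d x • y), comm, hcomm z y]
      one_mul := hone
      mul_one := fun x => hd x
      inv_mul_cancel := fun x => by
        change d (inv x • s) • x = s
        rw [key, hinv]
      mul_comm := hcomm }
  exact ⟨inst, rfl, fun g x => (key g x).symm⟩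

namespace ActionFamily

/-- Each set of the family is a group with identity `s i`, on which private elements act by
translations. -/
def ActsByTranslation (F : ActionFamily) [∀ i, CommGroup (F.S i)] : Prop :=
  (∀ i, F.s i = 1) ∧ ∀ i (g : F.G i) (x : F.S i), g • x = (g • F.s i) * x

/-! ## Products of public keys -/

section Words

variable {F : ActionFamily} [∀ i, CommGroup (F.S i)] {V J : Type}

/-- The product of the public keys of the users in `T`. -/
def word {i : F.ι} (g : V → F.G i) (T : Finset V) : F.S i := ∏ v ∈ T, g v • F.s i

/-- A view that consists of products of public keys. -/
def wordView (w : J → Finset V) : F.View V J := fun _ g _ j => word g (w j)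

theorem word_update [DecidableEq V] {i : F.ι} (g : V → F.G i) {T : Finset V} {v : V} (hv : v ∉ T) (h : F.G i) :
    word (Function.update g v h) T = word g T :=
  Finset.prod_congr rfl fun x hx => by
    rw [Function.update_of_ne (ne_of_mem_of_not_mem hx hv)]

end Words

/-! ### Multiplying entries of a view by public keys of simulated users -/

variable {F : ActionFamily} {V : Type} [Fintype V] [DecidableEq V] {J : Type} [Fintype J]
  {J' : Type} [Fintype J']

theorem ViewIndist.reindex {p q : F.View V J} (h : ViewIndist p q) (σ : J' → J) :
    ViewIndist (fun i g r j => p i g r (σ j)) (fun i g r j => q i g r (σ j)) := fun A hA => by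
  choose R hR hRv using fun j : J => F.exists_polyTime_viewData j
  let tr : Data → Data := fun x => Data.cons (Data.nth 0 x) (Data.cons (Data.nth 1 x)
    (Data.ofList ((Finset.univ : Finset J').toList.map fun j => R (σ j) x)))
  have htr : PolyTime tr := (PolyTime.nth 0).cons
    ((PolyTime.nth 1).cons (PolyTime.ofList_map _ fun j => hR (σ j)))
  have htr' : ∀ ℓ i (v : J → F.S i), tr (F.viewData ℓ i v) = F.viewData ℓ i fun j => v (σ j) :=
    fun ℓ i v => by
      simp only [tr, hRv]
      rfl
  simpa only [viewGame, htr'] using h _ (PPT.comp_polyTime hA htr)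

/-- The users in `U` occur in neither view, so they are simulated one at a time by `ViewIndist.act`.
-/
theorem ViewIndist.word_mul [∀ i, CommGroup (F.S i)] (hF : F.Efficient) (hmul : F.ActsByTranslation) {p q : F.View V J}
    (h : ViewIndist p q) (U : Finset V)
    (hp : ∀ v ∈ U, ∀ i g r h, p i (Function.update g v h) r = p i g r)
    (hq : ∀ v ∈ U, ∀ i g r h, q i (Function.update g v h) r = q i g r)
    (σ : J' → J) (T : J' → Finset V) (hT : ∀ j, T j ⊆ U) :
    ViewIndist (fun i g r j => word g (T j) * p i g r (σ j))
      (fun i g r j => word g (T j) * q i g r (σ j)) := by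
  induction U using Finset.induction_on generalizing T with
  | empty =>
    simp only [Finset.subset_empty] at hT
    simpa [hT, word] using h.reindex σ
  | @insert v U hv ih =>
    have ih' := ih (fun x hx => hp x (Finset.mem_insert_of_mem hx))
      (fun x hx => hq x (Finset.mem_insert_of_mem hx)) (fun j => (T j).erase v)
      fun j => Finset.subset_insert_iff.1 (hT j)
    have hact : ∀ p : F.View V J, View.act (fun i g r j => word g ((T j).erase v) * p i g r (σ j))
        v id (fun j => v ∈ T j) = fun i g r j => word g (T j) * p i g r (σ j) := fun p => by
      funext i g r j
      by_cases hj : v ∈ T j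
      · simp only [View.act, hj, if_true, id]
        rw [hmul.2, ← mul_assoc]
        exact congrArg (· * p i g r (σ j)) (Finset.mul_prod_erase _ (fun x => g x • F.s i) hj)
      · simp [View.act, hj]
    have hind : ∀ p : F.View V J,
        (∀ i g r h, p i (Function.update g v h) r = p i g r) → ∀ i g r h,
        (fun j => word (Function.update g v h) ((T j).erase v) *
          p i (Function.update g v h) r (σ j)) =
        fun j => word g ((T j).erase v) * p i g r (σ j) := fun p hp i g r h => by
      simp [hp, word_update]
    have := ViewIndist.act hF ih' v (hind p (hp v (Finset.mem_insert_self _ _)))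
      (hind q (hq v (Finset.mem_insert_self _ _))) id fun j => v ∈ T j
    rwa [hact, hact] at this

/-! ## Diffie–Hellman in context -/

/-- The two-party protocol between users with indices `a` and `b`. -/
theorem viewIndist_of_dh
    (hDH : F.KeyIndistinguishable 2 (fun i g => dhTranscript g (F.s i))
      (fun i g => dhKey g (F.s i))) {a b : V} (hab : a ≠ b) :
    ViewIndist (V := V) (J := Fin 4)
      (fun i g _ => ![F.s i, g a • F.s i, g b • F.s i, g a • g b • F.s i])
      (fun i g r => ![F.s i, g a • F.s i, g b • F.s i, r]) := fun A hA => by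
  let entry : Fin 4 → Data → Data := ![Data.nth 2, fun x => Data.nth 0 (Data.nth 0 (Data.nth 3 x)),
    fun x => Data.nth 0 (Data.nth 1 (Data.nth 3 x)), Data.nth 4]
  have hentry : ∀ j, PolyTime (entry j) := by
    intro j
    fin_cases j
    · exact PolyTime.nth 2
    · exact (PolyTime.nth 0).comp ((PolyTime.nth 0).comp (PolyTime.nth 3))
    · exact (PolyTime.nth 0).comp ((PolyTime.nth 1).comp (PolyTime.nth 3))
    · exact PolyTime.nth 4
  let tr : Data → Data := fun x => Data.cons (Data.nth 0 x) (Data.cons (Data.nth 1 x)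
    (Data.ofList ((Finset.univ : Finset (Fin 4)).toList.map fun j => entry j x)))
  have htr : PolyTime tr := (PolyTime.nth 0).cons
    ((PolyTime.nth 1).cons (PolyTime.ofList_map _ hentry))
  have htr' : ∀ ℓ i (g : Fin 2 → F.G i) (v : F.S i),
      tr (F.challenge ℓ i (dhTranscript (F.privateKeys g) (F.s i)) v) =
      F.viewData ℓ i ![F.s i, g 0 • F.s i, g 1 • F.s i, v] := fun ℓ i g v => by
    have : ∀ j, entry j (F.challenge ℓ i (dhTranscript (F.privateKeys g) (F.s i)) v) =
        Data.ofBits (F.encS i (![F.s i, g 0 • F.s i, g 1 • F.s i, v] j)) := by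
      intro j
      fin_cases j <;> rfl
    simp only [tr, this]
    rfl
  have he : Function.Injective ![a, b] := by
    intro x y
    fin_cases x <;> fin_cases y <;> simp [hab, hab.symm]
  have h := hDH _ (PPT.comp_polyTime hA htr)
  simp only [realGame, randomGame, htr'] at h
  simp only [← PMF.uniformOfFintype_map_comp_injective ![a, b] he, PMF.bind_map] at h
  simp only [viewGame, PMF.bind_const]
  exact h

variable [∀ i, CommGroup (F.S i)]

/-- In a context of products of public keys, the Diffie–Hellman key of the users `a` and `b` may be
replaced by a uniform element. -/
theorem wordView_indist (hF : F.Efficient) (hmul : F.ActsByTranslation)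
    (hDH : F.KeyIndistinguishable 2 (fun i g => dhTranscript g (F.s i))
      (fun i g => dhKey g (F.s i))) {a b : V} (hab : a ≠ b) (w : J → Finset V) :
    ViewIndist (F := F) (wordView w) (fun _ g r j =>
      if a ∈ w j ∧ b ∈ w j then word g (((w j).erase a).erase b) * r else word g (w j)) := by
  have hupd : ∀ v ∈ ((Finset.univ : Finset V).erase a).erase b, ∀ i (g : V → F.G i) (h : F.G i),
      Function.update g v h a = g a ∧ Function.update g v h b = g b := fun v hv i g h => by
    simp only [Finset.mem_erase] at hv
    exact ⟨Function.update_of_ne (Ne.symm hv.2.1) _ _, Function.update_of_ne (Ne.symm hv.1) _ _⟩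
  -- Each word is the product over the remaining users times one of the four Diffie–Hellman entries,
  -- selected by which of `a`, `b` it contains.
  have h := (viewIndist_of_dh hDH hab).word_mul hF hmul _
    (fun v hv i g r h => by simp only [hupd v hv])
    (fun v hv i g r h => by simp only [hupd v hv])
    (fun j => if a ∈ w j ∧ b ∈ w j then 3 else if a ∈ w j then 1 else if b ∈ w j then 2 else 0)
    (fun j => ((w j).erase a).erase b)
    fun j => Finset.erase_subset_erase _ (Finset.erase_subset_erase _ (Finset.subset_univ _))
  have hs := hmul.1
  convert h using 1 <;> funext i g r j <;> by_cases ha : a ∈ w j <;> by_cases hb : b ∈ w j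
  · have hb' : b ∈ (w j).erase a := Finset.mem_erase.2 ⟨hab.symm, hb⟩
    simp only [ha, hb, and_self, if_true, wordView, word]
    rw [← Finset.prod_erase_mul _ _ ha, ← Finset.prod_erase_mul _ _ hb', mul_assoc]
    congr 1
    rw [mul_comm]
    exact (hmul.2 _ _ _).symm
  · simp [ha, hb, wordView, word]
  · simp [ha, hb, wordView, word]
  · simp [ha, hb, wordView, hs]
  · simp [ha, hb]
  · simp [ha, hb, word]
  · simp [ha, hb, word]
  · simp [ha, hb, hs]

end ActionFamily

/-! ## The hybrid argument -/

namespace ActionFamily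

variable {F : ActionFamily} [∀ i, CommGroup (F.S i)] {κ : Type}

variable [Fintype κ] [DecidableEq κ]

/-- The products over all sets of users, where the product over `P` is replaced by the product over
the auxiliary users `E`. -/
def hybridWord (P : Finset κ) (E : Finset (Fin 4)) (T : Finset κ) : Finset (κ ⊕ Fin 4) :=
  if P ⊆ T then (T \ P).disjSum E else T.disjSum ∅

/-- Diffie–Hellman forwards on `p, q` and backwards on `y, z`: both views reduce to the same one,
with a uniform element in place of the pair. -/
theorem hybrid_pair (hF : F.Efficient) (hmul : F.ActsByTranslation)
    (hDH : F.KeyIndistinguishable 2 (fun i g => dhTranscript g (F.s i))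
      (fun i g => dhKey g (F.s i))) {p q : κ} (hpq : p ≠ q) {y z : Fin 4} (hyz : y ≠ z) :
    ViewIndist (F := F) (wordView fun T : Finset κ => T.disjSum (∅ : Finset (Fin 4)))
      (wordView (hybridWord {p, q} {y, z})) := by
  have h1 := wordView_indist hF hmul hDH (a := Sum.inl p) (b := Sum.inl q) (by simpa using hpq)
    fun T : Finset κ => T.disjSum (∅ : Finset (Fin 4))
  have h2 := wordView_indist hF hmul hDH (a := Sum.inr y) (b := Sum.inr z) (by simpa using hyz)
    (hybridWord {p, q} {y, z})
  refine h1.trans ((ViewIndist.of_eq ?_).trans h2.symm)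
  funext i g r T
  by_cases hT : p ∈ T ∧ q ∈ T
  · have hPT : ({p, q} : Finset κ) ⊆ T := by
      simpa [Finset.insert_subset_iff] using hT
    have e1 : (((T.disjSum ∅).erase (Sum.inl p)).erase (Sum.inl q) : Finset (κ ⊕ Fin 4)) =
        (T \ {p, q}).disjSum ∅ := by
      ext (x | x) <;> simp; tauto
    have e2 : ((((T \ {p, q}).disjSum {y, z}).erase (Sum.inr y)).erase (Sum.inr z) :
        Finset (κ ⊕ Fin 4)) = (T \ {p, q}).disjSum ∅ := by
      ext (x | x) <;> simp; tauto
    simp [hybridWord, hPT, hT, e1, e2, -Finset.disjSum_empty]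
  · have hPT : ¬({p, q} : Finset κ) ⊆ T := by
      simpa [Finset.insert_subset_iff] using hT
    simp [hybridWord, hPT, hT]

/-- With `P` already replaced by `y, z`, Diffie–Hellman on `y` and `p` yields `r`, a translation of
`r` absorbs the key of `z`, and Diffie–Hellman backwards yields `y', z'`. Sets containing `P` but
not `p` still carry `y, z`; the induction hypothesis, read backwards, restores them. For this the
pair `y', z'` must be disjoint from `y, z`, so that it can be simulated. -/
theorem hybrid_insert (hF : F.Efficient) (hmul : F.ActsByTranslation)
    (hDH : F.KeyIndistinguishable 2 (fun i g => dhTranscript g (F.s i))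
      (fun i g => dhKey g (F.s i))) {P : Finset κ} (hP : P.Nonempty) {p : κ} (hp : p ∉ P)
    {y z y' z' : Fin 4} (hyz : y ≠ z) (hyz' : y' ≠ z') (hy : y' ∉ ({y, z} : Finset (Fin 4)))
    (hz : z' ∉ ({y, z} : Finset (Fin 4)))
    (ih : ViewIndist (F := F) (wordView fun T : Finset κ => T.disjSum (∅ : Finset (Fin 4)))
      (wordView (hybridWord P {y, z}))) :
    ViewIndist (F := F) (wordView fun T : Finset κ => T.disjSum (∅ : Finset (Fin 4)))
      (wordView (hybridWord (insert p P) {y', z'})) := by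
  have h1 := wordView_indist hF hmul hDH (a := Sum.inr y) (b := Sum.inl p) (by simp)
    (hybridWord P {y, z})
  let w : Finset κ → Finset (κ ⊕ Fin 4) := fun T =>
    if insert p P ⊆ T then (T \ insert p P).disjSum {y', z'} else hybridWord P {y, z} T
  have h2 := wordView_indist hF hmul hDH (a := Sum.inr y') (b := Sum.inr z') (by simpa using hyz') w
  have h3 := ViewIndist.of_perm (F := F)
    (fun i g r T => if insert p P ⊆ T then word g ((T \ insert p P).disjSum ∅) * r
      else word g (hybridWord P {y, z} T)) fun i g => Equiv.mulLeft (g (Sum.inr z) • F.s i)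
  -- Where `insert p P ⊆ T`, the set looked up is `T \ insert p P`. It does not contain the nonempty
  -- `P`, so both sides of `ih` give it the same plain product.
  have h4 := ih.word_mul hF hmul {Sum.inr y', Sum.inr z'}
    (fun v hv i g r h => by
      funext T
      refine word_update g ?_ h
      simp only [Finset.mem_insert, Finset.mem_singleton] at hv
      rcases hv with rfl | rfl <;> simp)
    (fun v hv i g r h => by
      funext T
      refine word_update g ?_ h
      simp only [Finset.mem_insert, Finset.mem_singleton] at hv
      rcases hv with rfl | rfl <;> unfold hybridWord <;> split_ifs <;> simp_all)
    (fun T : Finset κ => if insert p P ⊆ T then T \ insert p P else T)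
    (fun T => if insert p P ⊆ T then (∅ : Finset κ).disjSum {y', z'} else ∅)
    (fun T => by
      split_ifs
      · intro x
        rcases x with x | x <;> simp
      · simp)
  refine ih.trans (h1.trans ((ViewIndist.of_eq ?_).trans (h3.trans ((ViewIndist.of_eq ?_).trans
    (h2.symm.trans ((ViewIndist.of_eq ?_).trans (h4.symm.trans (ViewIndist.of_eq ?_))))))))
  · funext i g r T
    by_cases hT : insert p P ⊆ T
    · obtain ⟨hpT, hPT⟩ := Finset.insert_subset_iff.1 hT
      have e : (((T \ P).disjSum {y, z}).erase (Sum.inr y)).erase (Sum.inl p) =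
          (T \ insert p P).disjSum {z} := by
        ext (x | x) <;> simp <;> grind
      simp [hybridWord, hT, hPT, hpT, hp, e, word, mul_assoc]
    · have : ¬(Sum.inr y ∈ hybridWord P {y, z} T ∧ Sum.inl p ∈ hybridWord P {y, z} T) := by
        rw [Finset.insert_subset_iff] at hT
        unfold hybridWord
        split_ifs <;> simp_all
      simp [hT, this]
  · funext i g r T
    by_cases hT : insert p P ⊆ T
    · have e : (((T \ insert p P).disjSum {y', z'}).erase (Sum.inr y')).erase (Sum.inr z') =
          (T \ insert p P).disjSum ∅ := by
        ext (x | x) <;> simp; tauto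
      simp [w, hT, e]
    · have : ¬(Sum.inr y' ∈ hybridWord P {y, z} T) := by
        unfold hybridWord
        split_ifs <;> simp_all
      simp [w, hT, this]
  · funext i g r T
    by_cases hT : insert p P ⊆ T
    · have hP' : ¬P ⊆ T \ insert p P := fun h => by
        obtain ⟨x, hx⟩ := hP
        have := h hx
        simp [hx] at this
      simp [w, hT, wordView, hybridWord, hP', mul_comm, word, hyz']
    · simp [w, hT, wordView, word]
  · funext i g r T
    by_cases hT : insert p P ⊆ T
    · simp [hT, wordView, hybridWord, mul_comm, word, hyz']
    · simp [hT, wordView, hybridWord, word]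

theorem hybrid (hF : F.Efficient) (hmul : F.ActsByTranslation)
    (hDH : F.KeyIndistinguishable 2 (fun i g => dhTranscript g (F.s i))
      (fun i g => dhKey g (F.s i))) (P : Finset κ) (hP : 2 ≤ P.card) :
    ∀ y z : Fin 4, y ≠ z →
      ViewIndist (F := F) (wordView fun T : Finset κ => T.disjSum (∅ : Finset (Fin 4)))
        (wordView (hybridWord P {y, z})) := by
  induction P using Finset.induction_on with
  | empty => simp at hP
  | @insert p P hp ih =>
    intro y' z' hyz'
    rw [Finset.card_insert_of_notMem hp] at hP
    rcases (show 1 ≤ P.card by omega).eq_or_lt with h1 | h2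
    · obtain ⟨q, rfl⟩ := Finset.card_eq_one.1 h1.symm
      exact hybrid_pair hF hmul hDH (by simpa using hp) hyz'
    -- Four auxiliary users suffice: each insertion passes from one pair to a disjoint one.
    · obtain ⟨y, z, hyz, hy, hz⟩ : ∃ y z : Fin 4, y ≠ z ∧ y' ∉ ({y, z} : Finset (Fin 4)) ∧
          z' ∉ ({y, z} : Finset (Fin 4)) := by
        revert y' z'
        decide
      exact hybrid_insert hF hmul hDH (Finset.card_pos.1 (by omega)) hp hyz hyz' hy hz
        (ih h2 y z hyz)

/-- The product of the public keys of all users is indistinguishable from a random value, given the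
products over all proper subsets. -/
theorem word_univ_indist (hF : F.Efficient) (hmul : F.ActsByTranslation)
    (hDH : F.KeyIndistinguishable 2 (fun i g => dhTranscript g (F.s i))
      (fun i g => dhKey g (F.s i))) (hκ : 2 ≤ Fintype.card κ) :
    ViewIndist (F := F) (fun _ (g : κ ⊕ Fin 4 → F.G _) _ T => word (g ∘ Sum.inl) T)
      (fun _ g r T => if T = Finset.univ then r else word (g ∘ Sum.inl) T) := by
  -- Only the full set contains `univ`, so only the key is replaced, by the Diffie–Hellman key of
  -- the auxiliary users 0 and 1.
  have h1 := hybrid hF hmul hDH (Finset.univ : Finset κ) hκ 0 1 (by decide)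
  have h2 := wordView_indist hF hmul hDH (a := Sum.inr 0) (b := Sum.inr 1) (by simp)
    (hybridWord (Finset.univ : Finset κ) {0, 1})
  convert h1.trans h2 using 1 <;> funext i g r T
  · simp [wordView, word]
  · by_cases hT : T = Finset.univ
    · simp [hT, hybridWord, word]
    · simp [hT, hybridWord, Finset.univ_subset_iff, word]

end ActionFamily

/-! ## The messages as products of public keys -/

namespace ActionFamily

variable {F : ActionFamily} [∀ i, CommGroup (F.S i)]

/-- A protocol in which all messages are products of the public keys of proper subsets of the users,
and the key is the product of all public keys. -/
theorem keyIndistinguishable_of_word (hF : F.Efficient) (hmul : F.ActsByTranslation)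
    (hDH : F.KeyIndistinguishable 2 (fun i g => dhTranscript g (F.s i))
      (fun i g => dhKey g (F.s i))) {n : ℕ} (hn : 2 ≤ n)
    {T : ∀ i, (ℕ → F.G i) → List (List (F.S i))} {K : ∀ i, (ℕ → F.G i) → F.S i}
    (m : List (List (Finset ℕ))) (hm : ∀ l ∈ m, ∀ t ∈ l, t ⊂ Finset.Icc 1 n)
    (hT : ∀ i g, T i g = m.map fun l => l.map fun t => word g t)
    (hK : ∀ i g, K i g = word g (Finset.Icc 1 n)) : F.KeyIndistinguishable n T K := fun A hA => by
  let idx : Finset ℕ → Finset (Fin n) := fun t => {x | (x : ℕ) + 1 ∈ t}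
  have hword : ∀ i (g : Fin n → F.G i) t, t ⊆ Finset.Icc 1 n →
      word (F.privateKeys g) t = word g (idx t) := fun i g t ht => by
    symm
    refine Finset.prod_bij (fun x _ => (x : ℕ) + 1) (fun x hx => by simpa [idx] using hx)
      (fun x _ y _ h => by simpa [Fin.ext_iff] using h) (fun y hy => ?_) fun x _ => ?_
    · have := Finset.mem_Icc.1 (ht hy)
      refine ⟨⟨y - 1, by omega⟩, ?_, ?_⟩ <;> simp [idx, Nat.sub_add_cancel this.1, hy]
    · simp [privateKeys]
  have huniv : idx (Finset.Icc 1 n) = Finset.univ := by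
    ext x
    simp [idx]
  have hne : ∀ t, t ⊂ Finset.Icc 1 n → idx t ≠ Finset.univ := fun t ht h => by
    obtain ⟨x, hx, hxt⟩ := Finset.exists_of_ssubset ht
    rw [Finset.mem_Icc] at hx
    have := Finset.mem_univ (⟨x - 1, by omega⟩ : Fin n)
    rw [← h] at this
    simp [idx, Nat.sub_add_cancel hx.1, hxt] at this
  choose R hR hRv using fun j : Finset (Fin n) => F.exists_polyTime_viewData j
  -- The challenge is rebuilt from the view of all products: `∅` supplies the public element `s`,
  -- and `univ` supplies the key or its random substitute.
  let tr : Data → Data := fun x => Data.cons (Data.nth 0 x) (Data.cons (Data.nth 1 x)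
    (Data.cons (R ∅ x) (Data.cons
      (Data.ofList (m.map fun l => Data.ofList (l.map fun t => R (idx t) x)))
      (Data.cons (R Finset.univ x) Data.nil))))
  have htr : PolyTime tr := (PolyTime.nth 0).cons ((PolyTime.nth 1).cons ((hR _).cons
    ((PolyTime.ofList_map m fun l => PolyTime.ofList_map l fun t => hR _).cons
      ((hR _).cons PolyTime.nil))))
  have htr' : ∀ ℓ i (g : Fin n → F.G i) (v : Finset (Fin n) → F.S i),
      (∀ t, t ≠ Finset.univ → v t = word g t) → tr (F.viewData ℓ i v) =
        F.challenge ℓ i (T i (F.privateKeys g)) (v Finset.univ) := fun ℓ i g v hv => by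
    have h0 : v ∅ = F.s i := by
      rw [hv, hmul.1]
      · simp [word]
      · have : Nonempty (Fin n) := ⟨⟨0, by omega⟩⟩
        exact Finset.univ_nonempty.ne_empty.symm
    have h1 : ∀ l ∈ m, Data.ofList (l.map fun t => Data.ofBits (F.encS i (v (idx t)))) =
        Data.ofList ((l.map fun t => word (F.privateKeys g) t).map
          fun x => Data.ofBits (F.encS i x)) := fun l hl => by
      rw [List.map_map]
      congr 1
      refine List.map_congr_left fun t ht => ?_
      rw [Function.comp_apply, hword i g t (hm l hl t ht).subset, hv _ (hne t (hm l hl t ht))]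
    simp only [tr, hRv, h0, List.map_congr_left h1, challenge, hT, List.map_map, Function.comp_def]
    rfl
  have h := word_univ_indist (κ := Fin n) hF hmul hDH (by simpa using hn) _
    (PPT.comp_polyTime hA htr)
  have hreal : ∀ i (g : Fin n → F.G i) ℓ, tr (F.viewData ℓ i fun t => word g t) =
      F.challenge ℓ i (T i (F.privateKeys g)) (K i (F.privateKeys g)) := fun i g ℓ => by
    rw [htr' ℓ i g _ fun _ _ => rfl, hK, hword i g _ subset_rfl, huniv]
  have hrand : ∀ i (g : Fin n → F.G i) (r : F.S i) ℓ,
      tr (F.viewData ℓ i fun t => if t = Finset.univ then r else word g t) =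
        F.challenge ℓ i (T i (F.privateKeys g)) r := fun i g r ℓ => by
    rw [htr' ℓ i g _ fun t ht => if_neg ht, if_pos rfl]
  simp only [viewGame, hreal, hrand, PMF.bind_const] at h
  simp only [realGame, randomGame]
  -- The auxiliary users no longer occur, so their private elements are marginalized out.
  simp only [← PMF.uniformOfFintype_map_comp_injective (Sum.inl : Fin n → Fin n ⊕ Fin 4)
    Sum.inl_injective, PMF.bind_map]
  exact h

/-! ### The user sets behind each protocol value -/

variable {i : F.ι} (g : ℕ → F.G i)

theorem smul_word (hmul : F.ActsByTranslation) {v : ℕ} {T U : Finset ℕ} (hv : v ∉ T)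
    (hU : insert v T = U) : g v • word g T = word g U := by
  rw [← hU, word, word, Finset.prod_insert hv, hmul.2]

theorem word_empty (hmul : F.ActsByTranslation) : word g ∅ = F.s i := by
  rw [hmul.1, word, Finset.prod_empty]

theorem chain_eq_word (hmul : F.ActsByTranslation) (k : ℕ) :
    chain g (F.s i) k = word g (Finset.Icc 1 k) := by
  induction k with
  | zero => exact (word_empty g hmul).symm
  | succ k ih =>
    rw [chain, ih]
    exact smul_word g hmul (by simp) (by ext; simp; omega)

/-- The upward chain contributes users below `j`, the downward pass those from `n - d` to `n`; the
gap between them is missing. -/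
theorem gsap1Aux_eq_word (hmul : F.ActsByTranslation) {n j d : ℕ} (hj : 1 ≤ j) (hd : j + d < n) :
    gsap1Aux n g (F.s i) j d = word g (Finset.Icc 1 n \ Finset.Ico j (n - d)) := by
  induction d with
  | zero =>
    rw [gsap1Aux, chain_eq_word g hmul]
    exact smul_word g hmul (by simp; omega) (by ext; simp; omega)
  | succ d ih =>
    rw [gsap1Aux, ih (by omega)]
    exact smul_word g hmul (by simp; omega) (by ext; simp; omega)

theorem gsap1F_eq_word (hmul : F.ActsByTranslation) {n k j : ℕ} (hj : 1 ≤ j) (hjk : j < k)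
    (hk : k ≤ n) : gsap1F n g (F.s i) k j = word g (Finset.Icc 1 n \ Finset.Ico j k) := by
  rw [gsap1F, gsap1Aux_eq_word g hmul hj (by omega), Nat.sub_sub_self hk]

theorem gsap1Key_eq_word (hmul : F.ActsByTranslation) {n k : ℕ} (hk : 1 ≤ k) (hkn : k ≤ n) :
    gsap1Key n g (F.s i) k = word g (Finset.Icc 1 n) := by
  rw [gsap1Key]
  split_ifs with h
  · rw [chain_eq_word g hmul]
    exact smul_word g hmul (by simp; omega) (by ext; simp; omega)
  · rw [gsap1F_eq_word g hmul hk (by omega) (by omega)]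
    exact smul_word g hmul (by simp) (by ext; simp; omega)

/-- The index `j` encodes the omitted user `k - j`; for `j = k` this is 0, so nothing is erased. -/
theorem gsap2C_eq_word (hmul : F.ActsByTranslation) (k j : ℕ) (hj : 1 ≤ j ∨ k = 0) (hjk : j ≤ k) :
    gsap2C g (F.s i) k j = word g ((Finset.Icc 1 k).erase (k - j)) := by
  induction k, j using gsap2C.induct with
  | case1 j => simp [gsap2C, ← word_empty g hmul]
  | case2 j =>
    obtain rfl : j = 1 := by omega
    rw [gsap2C, ← word_empty g hmul]
    exact smul_word g hmul (by simp) (by ext; simp)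
  | case3 k j h ih =>
    rw [gsap2C, if_pos h, ih (by omega) le_rfl]
    exact smul_word g hmul (by simp) (by ext; simp; omega)
  | case4 k j h ih =>
    rw [gsap2C, if_neg h, ih (by omega) (by omega)]
    exact smul_word g hmul (by simp) (by ext; simp; omega)

theorem gsap2F_eq_word (hmul : F.ActsByTranslation) {n k : ℕ} (hn : 2 ≤ n) (hk : 1 ≤ k)
    (hkn : k ≤ n) : gsap2F n g (F.s i) k = word g ((Finset.Icc 1 n).erase k) := by
  rw [gsap2F]
  split_ifs with h h'
  · rw [gsap2C_eq_word g hmul _ _ (by omega) le_rfl]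
    congr 1
    ext
    simp
    omega
  · rw [gsap2C_eq_word g hmul _ _ (by omega) le_rfl]
    exact smul_word g hmul (by simp; omega) (by ext; simp; omega)
  · rw [gsap2C_eq_word g hmul _ _ (by omega) (by omega)]
    exact smul_word g hmul (by simp; omega) (by ext; simp; omega)

theorem gsap2Key_eq_word (hmul : F.ActsByTranslation) {n k : ℕ} (hn : 2 ≤ n) (hk : 1 ≤ k)
    (hkn : k ≤ n) : gsap2Key n g (F.s i) k = word g (Finset.Icc 1 n) := by
  rw [gsap2Key, gsap2F_eq_word g hmul hn hk hkn]
  exact smul_word g hmul (by simp) (Finset.insert_erase (by simp; omega))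

/-- The neutral element acts as an idempotent translation of a group, hence trivially. -/
theorem inv_smul_smul_of_isGroupInversion (hmul : F.ActsByTranslation) {inv : F.G i → F.G i}
    (hinv : IsGroupInversion inv) (a : F.G i) (x : F.S i) : inv a • a • x = x := by
  obtain ⟨e, he, hinv⟩ := hinv
  have h : e • e • x = e • x := by rw [← mul_smul, he]
  rw [← mul_smul, hinv]
  rw [hmul.2 i e (e • x), hmul.2 i e x] at h
  rw [hmul.2]
  exact mul_left_cancel h

theorem gsap3D_eq_word (hmul : F.ActsByTranslation) {inv : F.G i → F.G i}
    (hinv : IsGroupInversion inv) {n k : ℕ} (hk : 1 ≤ k) (hkn : k < n) :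
    gsap3D inv n g (F.s i) k = word g ((Finset.Icc 1 (n - 1)).erase k) := by
  rw [gsap3D, chain_eq_word g hmul, ← smul_word g hmul (Finset.notMem_erase k _)
    (Finset.insert_erase (by simp; omega)), inv_smul_smul_of_isGroupInversion hmul hinv]

theorem smul_gsap3D_eq_word (hmul : F.ActsByTranslation) {inv : F.G i → F.G i}
    (hinv : IsGroupInversion inv) {n k : ℕ} (hk : 1 ≤ k) (hkn : k < n) :
    g n • gsap3D inv n g (F.s i) k = word g ((Finset.Icc 1 n).erase k) := by
  rw [gsap3D_eq_word g hmul hinv hk hkn]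
  exact smul_word g hmul (by simp; omega) (by ext; simp; omega)

theorem gsap3Key_eq_word (hmul : F.ActsByTranslation) {inv : F.G i → F.G i}
    (hinv : IsGroupInversion inv) {n k : ℕ} (hk : 1 ≤ k) (hkn : k ≤ n) :
    gsap3Key inv n g (F.s i) k = word g (Finset.Icc 1 n) := by
  rw [gsap3Key]
  split_ifs with h
  · rw [chain_eq_word g hmul]
    exact smul_word g hmul (by simp; omega) (by ext; simp; omega)
  · rw [smul_gsap3D_eq_word g hmul hinv hk (by omega)]
    exact smul_word g hmul (by simp) (Finset.insert_erase (by simp; omega))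

/-- The sets of users whose public keys are multiplied in the messages of GSAP-1. -/
def gsap1Shape (n : ℕ) : List (List (Finset ℕ)) :=
  ((List.range' 1 (n - 1)).map fun i => (List.range' 1 i).map fun j => Finset.Icc 1 j) ++
  (List.range' 2 (n - 1)).reverse.map fun k =>
    (List.range' 1 (k - 1)).map fun j => Finset.Icc 1 n \ Finset.Ico j k

/-- The sets of users whose public keys are multiplied in the messages of GSAP-2. -/
def gsap2Shape (n : ℕ) : List (List (Finset ℕ)) :=
  ((List.range' 1 (n - 1)).map fun i =>
    Finset.Icc 1 (i - 1) :: (List.range' 1 i).map fun j => (Finset.Icc 1 i).erase (i - j)) ++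
  [(List.range' 1 n).map fun i => (Finset.Icc 1 n).erase i]

/-- The sets of users whose public keys are multiplied in the messages of GSAP-3. -/
def gsap3Shape (n : ℕ) : List (List (Finset ℕ)) :=
  ((List.range' 1 (n - 1)).map fun i => [Finset.Icc 1 i]) ++
  ((List.range' 1 (n - 1)).map fun i => [(Finset.Icc 1 (n - 1)).erase i]) ++
  [((List.range' 1 (n - 1)).map fun i => (Finset.Icc 1 n).erase i) ++ [Finset.Icc 1 (n - 1)]]

theorem gsap1Transcript_eq_word (hmul : F.ActsByTranslation) (n : ℕ) :
    gsap1Transcript n g (F.s i) = (gsap1Shape n).map fun l => l.map fun t => word g t := by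
  simp only [gsap1Transcript, gsap1Shape, List.map_append, List.map_map]
  congr 1
  · refine List.map_congr_left fun a _ => ?_
    simp only [Function.comp_apply, List.map_map]
    exact List.map_congr_left fun b _ => chain_eq_word g hmul b
  · refine List.map_congr_left fun k hk => ?_
    rw [List.mem_reverse, List.mem_range'_1] at hk
    simp only [Function.comp_apply, List.map_map]
    refine List.map_congr_left fun j hj => ?_
    rw [List.mem_range'_1] at hj
    exact gsap1F_eq_word g hmul hj.1 (by omega) (by omega)

theorem gsap2Transcript_eq_word (hmul : F.ActsByTranslation) {n : ℕ} (hn : 2 ≤ n) :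
    gsap2Transcript n g (F.s i) = (gsap2Shape n).map fun l => l.map fun t => word g t := by
  simp only [gsap2Transcript, gsap2Shape, List.map_append, List.map_map, List.map_cons,
    List.map_nil]
  congr 1
  · refine List.map_congr_left fun a ha => ?_
    simp only [Function.comp_apply, List.map_map, List.map_cons]
    congr 1
    · rw [gsap2C_eq_word g hmul _ _ (by omega) le_rfl]
      simp
    · refine List.map_congr_left fun j hj => ?_
      rw [List.mem_range'_1] at hj
      exact gsap2C_eq_word g hmul _ _ (by omega) (by omega)
  · congr 1
    refine List.map_congr_left fun j hj => ?_
    rw [List.mem_range'_1] at hj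
    exact gsap2F_eq_word g hmul hn (by omega) (by omega)

theorem gsap3Transcript_eq_word (hmul : F.ActsByTranslation) {inv : F.G i → F.G i}
    (hinv : IsGroupInversion inv) (n : ℕ) :
    gsap3Transcript inv n g (F.s i) = (gsap3Shape n).map fun l => l.map fun t => word g t := by
  simp only [gsap3Transcript, gsap3Shape, List.map_append, List.map_map, List.map_cons,
    List.map_nil, chain_eq_word g hmul]
  congr 1
  · congr 1
    refine List.map_congr_left fun k hk => ?_
    rw [List.mem_range'_1] at hk
    simp [gsap3D_eq_word g hmul hinv hk.1 (show k < n by omega)]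
  · congr 2
    refine List.map_congr_left fun k hk => ?_
    rw [List.mem_range'_1] at hk
    exact smul_gsap3D_eq_word g hmul hinv hk.1 (by omega)

/-! ### Every message omits some user -/

theorem ssubset_Icc_of_notMem {n : ℕ} {t : Finset ℕ} (a : ℕ) (ha : 1 ≤ a) (han : a ≤ n)
    (hat : a ∉ t) (ht : ∀ x ∈ t, 1 ≤ x ∧ x ≤ n) : t ⊂ Finset.Icc 1 n :=
  (Finset.ssubset_iff_of_subset fun x hx => Finset.mem_Icc.2 (ht x hx)).2
    ⟨a, Finset.mem_Icc.2 ⟨ha, han⟩, hat⟩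

theorem ssubset_of_mem_gsap1Shape {n : ℕ} : ∀ l ∈ gsap1Shape n, ∀ t ∈ l,
    t ⊂ Finset.Icc 1 n := by
  intro l hl t ht
  simp only [gsap1Shape, List.mem_append, List.mem_map, List.mem_reverse, List.mem_range'_1] at hl
  rcases hl with ⟨a, ha, rfl⟩ | ⟨k, hk, rfl⟩ <;>
    simp only [List.mem_map, List.mem_range'_1] at ht <;> obtain ⟨j, hj, rfl⟩ := ht
  · exact ssubset_Icc_of_notMem n (by omega) le_rfl (by simp; omega) (by simp; omega)
  · exact ssubset_Icc_of_notMem j (by omega) (by omega) (by simp; omega) (by simp; omega)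

theorem ssubset_of_mem_gsap2Shape {n : ℕ} : ∀ l ∈ gsap2Shape n, ∀ t ∈ l,
    t ⊂ Finset.Icc 1 n := by
  intro l hl t ht
  simp only [gsap2Shape, List.mem_append, List.mem_map, List.mem_range'_1,
    List.mem_singleton] at hl
  rcases hl with ⟨a, ha, rfl⟩ | rfl
  · simp only [List.mem_cons, List.mem_map, List.mem_range'_1] at ht
    rcases ht with rfl | ⟨j, hj, rfl⟩ <;>
      exact ssubset_Icc_of_notMem n (by omega) le_rfl (by simp; omega) (by simp; omega)
  · simp only [List.mem_map, List.mem_range'_1] at ht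
    obtain ⟨j, hj, rfl⟩ := ht
    exact Finset.erase_ssubset (by simp; omega)

theorem ssubset_of_mem_gsap3Shape {n : ℕ} (hn : 2 ≤ n) : ∀ l ∈ gsap3Shape n, ∀ t ∈ l,
    t ⊂ Finset.Icc 1 n := by
  intro l hl t ht
  simp only [gsap3Shape, List.mem_append, List.mem_map, List.mem_range'_1,
    List.mem_singleton] at hl
  rcases hl with (⟨a, ha, rfl⟩ | ⟨a, ha, rfl⟩) | rfl
  · rw [List.mem_singleton] at ht
    subst ht
    exact ssubset_Icc_of_notMem n (by omega) le_rfl (by simp; omega) (by simp; omega)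
  · rw [List.mem_singleton] at ht
    subst ht
    exact ssubset_Icc_of_notMem n (by omega) le_rfl (by simp; omega) (by simp; omega)
  · simp only [List.mem_append, List.mem_map, List.mem_range'_1, List.mem_singleton] at ht
    rcases ht with ⟨j, hj, rfl⟩ | rfl
    · exact Finset.erase_ssubset (by simp; omega)
    · exact ssubset_Icc_of_notMem n (by omega) le_rfl (by simp; omega) (by simp; omega)

end ActionFamily

theorem mainTheorem1 (F : ActionFamily) (hF : F.Efficient) (htrans : F.Transitive)
    (hDH : F.KeyIndistinguishable 2 (fun i g => dhTranscript g (F.s i)) (fun i g => dhKey g (F.s i)))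
    (n : ℕ) (hn : 2 ≤ n) (k : ℕ) (hk : k ∈ Finset.Icc 1 n) :
    F.KeyIndistinguishable n (fun i g => gsap1Transcript n g (F.s i))
        (fun i g => gsap1Key n g (F.s i) k) ∧
      F.KeyIndistinguishable n (fun i g => gsap2Transcript n g (F.s i))
        (fun i g => gsap2Key n g (F.s i) k) ∧
      ∀ inv : ∀ i, F.G i → F.G i, (∀ i, IsGroupInversion (inv i)) →
        F.KeyIndistinguishable n (fun i g => gsap3Transcript (inv i) n g (F.s i))
          (fun i g => gsap3Key (inv i) n g (F.s i) k) := by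
  obtain ⟨hk1, hkn⟩ := Finset.mem_Icc.1 hk
  -- The chosen group structures serve as instances for all the lemmas about words.
  choose inst hone hact using fun i => exists_commGroup_of_transitive (F.s i) (htrans i)
  have hmul : F.ActsByTranslation := ⟨fun i => (hone i).symm, hact⟩
  refine ⟨?_, ?_, fun inv hinv => ?_⟩
  · exact ActionFamily.keyIndistinguishable_of_word hF hmul hDH hn (ActionFamily.gsap1Shape n)
      ActionFamily.ssubset_of_mem_gsap1Shape
      (fun i g => ActionFamily.gsap1Transcript_eq_word g hmul n)
      fun i g => ActionFamily.gsap1Key_eq_word g hmul hk1 hkn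
  · exact ActionFamily.keyIndistinguishable_of_word hF hmul hDH hn (ActionFamily.gsap2Shape n)
      ActionFamily.ssubset_of_mem_gsap2Shape
      (fun i g => ActionFamily.gsap2Transcript_eq_word g hmul hn)
      fun i g => ActionFamily.gsap2Key_eq_word g hmul hn hk1 hkn
  · exact ActionFamily.keyIndistinguishable_of_word hF hmul hDH hn (ActionFamily.gsap3Shape n)
      (ActionFamily.ssubset_of_mem_gsap3Shape hn)
      (fun i g => ActionFamily.gsap3Transcript_eq_word g hmul (hinv i) n)
      fun i g => ActionFamily.gsap3Key_eq_word g hmul (hinv i) hk1 hkn
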